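/- Let $(M,g)$ be a smooth Lorentzian manifold (signature $(-,+,\dots,+)$) of dimension $n+2$, $n\ge 1$ (the usual case being $n=2$), and suppose that $M$ admits a spacetime convex function, i.e. a smooth function $f:M\to\mathbb R$ whose Hessian $\nabla_\mu\nabla_\nu f$ (for the Levi-Civita connection of $g$) has Lorentzian signature $(-,+,\dots,+)$ everywhere and for which there is a constant $c>0$ with $V^\mu V^\nu\nabla_\mu\nabla_\nu f\ge c\,g_{\mu\nu}V^\mu V^\nu$ for all tangent vectors $V$. Let $S\subset M$ be a closed spacelike surface, i.e. a non-empty compact smooth embedded submanifold without boundary of dimension $n$ (codimension two) on which $g$ induces a positive definite metric. Suppose that in a neighbourhood of $S$ the metric is written as $$g_{\mu\nu}dx^\mu dx^\nu=\gamma_{ab}\,dy^a dy^b+k_{pq}\,dz^p dz^q\qquad(a,b=1,2;\ p,q=1,\dots,n),$$ where $k_{pq}dz^pdz^q$ is the metric on $S$ and the components of the two-dimensional Lorentzian metric $\gamma_{ab}$ are independent of the coordinates $z^p$; that is, every point of $S$ lies in a coordinate chart $(y^a,z^p)$ of $M$ in which $g$ has this form, with $\gamma_{ab}$ a function of $y$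 only, and in which $S$ is given by $y^a=\mathrm{const}$ (the $k_{pq}$ may depend on both $y$ and $z$). Then $S$ is not marginally inner and outer trapped; that is, it is not the case that both null expansions of $S$ vanish identically. Here, for a null vector field $\ell$ along (an open part of) $S$ and orthogonal to $S$, the expansion is $\theta_\ell=h^{ij}g(\nabla_{E_i}\ell,E_j)$, with $E_i$ a frame tangent to $S$ and $h_{ij}=g(E_i,E_j)$, and both null expansions are said to vanish if near every point of $S$ there are two linearly independent smooth null normal fields along $S$ whose expansions are zero. -/

import Mathlib

open scoped Manifold ContDiff Matrix
open Bundle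

noncomputable section

/-- The model space `ℝ^d` of `d`-dimensional manifolds. -/
abbrev Model (d : ℕ) : Type := EuclideanSpace ℝ (Fin d)

/-- The `i`-th coordinate vector of `ℝ^d`. -/
abbrev coordVec {d : ℕ} (i : Fin d) : Model d := EuclideanSpace.single i (1 : ℝ)

/-- The partial derivative `∂_i F (u)` of a real function on (an open subset of) `ℝ^d`. -/
def partialDeriv {d : ℕ} (i : Fin d) (F : Model d → ℝ) (u : Model d) : ℝ :=
  fderiv ℝ F u (coordVec i)

/-- A real quadratic form has Lorentzian signature `(-,+,…,+)` if its negative index of inertia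
is `1` and its positive index of inertia is `dim V - 1` (so that it is nondegenerate). -/
def IsLorentzianForm {V : Type*} [AddCommGroup V] [Module ℝ V]
    (Q : QuadraticForm ℝ V) : Prop :=
  sigNeg Q = 1 ∧ sigPos Q + 1 = Module.finrank ℝ V

/-- A smooth Lorentzian metric on a `d`-dimensional smooth manifold `M`. -/
structure LorentzMetric (d : ℕ) (M : Type*) [TopologicalSpace M] [ChartedSpace (Model d) M]
    [IsManifold (𝓡 d) ∞ M] where
  /-- The scalar product on the tangent spaces. -/
  inner (x : M) : TangentSpace (𝓡 d) x →L[ℝ] TangentSpace (𝓡 d) x →L[ℝ] ℝ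
  symm (x : M) (v w : TangentSpace (𝓡 d) x) : inner x v w = inner x w v
  lorentzian (x : M) : IsLorentzianForm (LinearMap.BilinMap.toQuadraticMap (inner x).toBilinForm)
  contMDiff : ContMDiff (𝓡 d) ((𝓡 d).prod 𝓘(ℝ, Model d →L[ℝ] Model d →L[ℝ] ℝ)) ∞
    (fun x ↦ TotalSpace.mk' (Model d →L[ℝ] Model d →L[ℝ] ℝ)
      (E := fun x : M ↦ TangentSpace (𝓡 d) x →L[ℝ] TangentSpace (𝓡 d) x →L[ℝ] ℝ) x (inner x))

section Coordinates

variable {d : ℕ} {M : Type*} [TopologicalSpace M] [ChartedSpace (Model d) M]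
  [IsManifold (𝓡 d) ∞ M]

/-- The coordinate vector field `∂_μ` of the chart `φ`, at the point with coordinates `u`. -/
def coordField (φ : OpenPartialHomeomorph M (Model d)) (μ : Fin d) (u : Model d) :
    TangentSpace (𝓡 d) (φ.symm u) :=
  mfderiv (𝓡 d) (𝓡 d) φ.symm u (coordVec μ)

/-- The components `v^μ = dx^μ(v)` of a tangent vector at `x` in the chart `φ`. -/
def vecComp (φ : OpenPartialHomeomorph M (Model d)) (x : M) (v : TangentSpace (𝓡 d) x)
    (μ : Fin d) : ℝ :=
  (EuclideanSpace.proj μ : Model d →L[ℝ] ℝ) (mfderiv (𝓡 d) (𝓡 d) φ x v)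

namespace LorentzMetric

variable (g : LorentzMetric d M)

/-- The matrix `g_{μν} = g(∂_μ, ∂_ν)` of components of the metric in the chart `φ`, at the point
with coordinates `u`. -/
def comp (φ : OpenPartialHomeomorph M (Model d)) (u : Model d) : Matrix (Fin d) (Fin d) ℝ :=
  Matrix.of fun μ ν ↦ g.inner (φ.symm u) (coordField φ μ u) (coordField φ ν u)

/-- The Christoffel symbols
`Γ^l_{μν} = ½ ∑_σ g^{lσ} (∂_μ g_{νσ} + ∂_ν g_{μσ} - ∂_σ g_{μν})` of the Levi-Civita connection
in the chart `φ`. -/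
def christoffel (φ : OpenPartialHomeomorph M (Model d)) (u : Model d) (l μ ν : Fin d) : ℝ :=
  (1 / 2) * ∑ σ, (g.comp φ u)⁻¹ l σ *
    (partialDeriv μ (fun u' ↦ g.comp φ u' ν σ) u + partialDeriv ν (fun u' ↦ g.comp φ u' μ σ) u
      - partialDeriv σ (fun u' ↦ g.comp φ u' μ ν) u)

/-- The components `∇_μ ∇_ν f = ∂_μ ∂_ν f - ∑_l Γ^l_{μν} ∂_l f` of the Hessian of `f` in the
chart `φ`. -/
def hessian (φ : OpenPartialHomeomorph M (Model d)) (f : M → ℝ) (u : Model d) :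
    Matrix (Fin d) (Fin d) ℝ :=
  Matrix.of fun μ ν ↦ partialDeriv μ (partialDeriv ν (f ∘ φ.symm)) u
    - ∑ l, g.christoffel φ u l μ ν * partialDeriv l (f ∘ φ.symm) u

/-- Spacetime convex functions: smooth functions whose Hessian has Lorentzian signature and
satisfies `V^μ V^ν ∇_μ ∇_ν f ≥ c g_{μν} V^μ V^ν` for all tangent vectors `V`, for some constant
`c > 0`. Both conditions are tensorial; they are written out in all smooth charts. -/
def IsSpacetimeConvex (f : M → ℝ) : Prop :=
  ContMDiff (𝓡 d) 𝓘(ℝ, ℝ) ∞ f ∧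
  (∀ φ ∈ IsManifold.maximalAtlas (𝓡 d) ∞ M, ∀ u ∈ φ.target,
    IsLorentzianForm (g.hessian φ f u).toQuadraticForm') ∧
  ∃ c : ℝ, 0 < c ∧ ∀ φ ∈ IsManifold.maximalAtlas (𝓡 d) ∞ M, ∀ u ∈ φ.target, ∀ V : Fin d → ℝ,
    c * ∑ μ, ∑ ν, g.comp φ u μ ν * V μ * V ν ≤ ∑ μ, ∑ ν, g.hessian φ f u μ ν * V μ * V ν

section Surface

variable {n : ℕ} {S : Type*} [TopologicalSpace S] [ChartedSpace (Model n) S]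

/-- The submanifold parametrized by `ι : S → M` is spacelike: the induced metric is positive
definite. -/
def IsSpacelike (ι : S → M) : Prop :=
  ∀ (s : S) (v : TangentSpace (𝓡 n) s), v ≠ 0 →
    0 < g.inner (ι s) (mfderiv (𝓡 n) (𝓡 d) ι s v) (mfderiv (𝓡 n) (𝓡 d) ι s v)

/-- `L` is a smooth field of null vectors orthogonal to the submanifold `ι : S → M`, defined on
the subset `W` of `S`. -/
def IsNullNormalOn (ι : S → M) (W : Set S) (L : ∀ s : S, TangentSpace (𝓡 d) (ι s)) : Prop :=
  ContMDiffOn (𝓡 n) (𝓡 d).tangent ∞ (fun s ↦ (⟨ι s, L s⟩ : TangentBundle (𝓡 d) M)) W ∧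
  ∀ s ∈ W, L s ≠ 0 ∧ g.inner (ι s) (L s) (L s) = 0 ∧
    ∀ v : TangentSpace (𝓡 n) s, g.inner (ι s) (L s) (mfderiv (𝓡 n) (𝓡 d) ι s v) = 0

/-- The components `E_i^μ = ∂_i (φ^μ ∘ ι ∘ ψ⁻¹)` of the tangent vectors `E_i = dι(∂_i)`, where
`φ` and `ψ` are charts of `M` and `S`. -/
def tangentComp (φ : OpenPartialHomeomorph M (Model d)) (ψ : OpenPartialHomeomorph S (Model n))
    (ι : S → M) (w : Model n) (i : Fin n) (μ : Fin d) : ℝ :=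
  partialDeriv i (fun w' ↦ φ (ι (ψ.symm w')) μ) w

/-- The matrix `h_{ij} = g(E_i, E_j)` of the induced metric. -/
def inducedComp (φ : OpenPartialHomeomorph M (Model d)) (ψ : OpenPartialHomeomorph S (Model n))
    (ι : S → M) (w : Model n) : Matrix (Fin n) (Fin n) ℝ :=
  Matrix.of fun i j ↦ ∑ μ, ∑ ν, g.comp φ (φ (ι (ψ.symm w))) μ ν *
    tangentComp φ ψ ι w i μ * tangentComp φ ψ ι w j ν

/-- The components `(∇_i L)^l = ∂_i L^l + ∑_{μν} Γ^l_{μν} E_i^μ L^ν` of the covariant derivative,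
in the direction `E_i`, of a vector field `L` along `ι`. -/
def covDerivAlong (φ : OpenPartialHomeomorph M (Model d))
    (ψ : OpenPartialHomeomorph S (Model n)) (ι : S → M) (L : ∀ s : S, TangentSpace (𝓡 d) (ι s))
    (w : Model n) (i : Fin n) (l : Fin d) : ℝ :=
  partialDeriv i (fun w' ↦ vecComp φ (ι (ψ.symm w')) (L (ψ.symm w')) l) w
    + ∑ μ, ∑ ν, g.christoffel φ (φ (ι (ψ.symm w))) l μ ν * tangentComp φ ψ ι w i μ *
        vecComp φ (ι (ψ.symm w)) (L (ψ.symm w)) ν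

/-- The expansion `θ_L = ∑_{ij} h^{ij} g(∇_i L, E_j)` of the submanifold `ι` along the normal
field `L`, at the point with coordinates `w`. -/
def expansion (φ : OpenPartialHomeomorph M (Model d)) (ψ : OpenPartialHomeomorph S (Model n))
    (ι : S → M) (L : ∀ s : S, TangentSpace (𝓡 d) (ι s)) (w : Model n) : ℝ :=
  ∑ i, ∑ j, (g.inducedComp φ ψ ι w)⁻¹ i j *
    ∑ l, ∑ κ, g.comp φ (φ (ι (ψ.symm w))) l κ * g.covDerivAlong φ ψ ι L w i l *
      tangentComp φ ψ ι w j κ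

/-- The expansion of `ι` along `L` vanishes at all points of `W`. The expansion does not depend on
the charts; the condition is written out in all smooth charts. -/
def ExpansionVanishesOn (ι : S → M) (W : Set S) (L : ∀ s : S, TangentSpace (𝓡 d) (ι s)) : Prop :=
  ∀ s ∈ W, ∀ φ ∈ IsManifold.maximalAtlas (𝓡 d) ∞ M, ∀ ψ ∈ IsManifold.maximalAtlas (𝓡 n) ∞ S,
    ι s ∈ φ.source → s ∈ ψ.source → g.expansion φ ψ ι L (ψ s) = 0

/-- A (codimension two, spacelike) surface is marginally inner and outer trapped if the expansions
of both families of null geodesics orthogonal to it vanish: near every point there are two linearly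
independent null normal fields, and the expansion along each of them vanishes. -/
def IsMarginallyInnerOuterTrapped (n : ℕ) {S : Type*} [TopologicalSpace S]
    [ChartedSpace (Model n) S] (ι : S → M) : Prop :=
  ∀ s₀ : S, ∃ W : Set S, IsOpen W ∧ s₀ ∈ W ∧
    ∃ L N : ∀ s : S, TangentSpace (𝓡 d) (ι s),
      g.IsNullNormalOn (n := n) ι W L ∧ g.IsNullNormalOn (n := n) ι W N ∧
      (∀ s ∈ W, LinearIndependent ℝ ![L s, N s]) ∧
      g.ExpansionVanishesOn (n := n) ι W L ∧ g.ExpansionVanishesOn (n := n) ι W N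

end Surface

end LorentzMetric

end Coordinates

section Splitting

variable {n : ℕ} {M : Type*} [TopologicalSpace M] [ChartedSpace (Model (2 + n)) M]
  [IsManifold (𝓡 (2 + n)) ∞ M]

/-- The index of the coordinate `y^a`, among coordinates `(y^1, y^2, z^1, …, z^n)`. -/
abbrev yIdx {n : ℕ} (a : Fin 2) : Fin (2 + n) := Fin.castAdd n a

/-- The index of the coordinate `z^p`, among coordinates `(y^1, y^2, z^1, …, z^n)`. -/
abbrev zIdx {n : ℕ} (p : Fin n) : Fin (2 + n) := Fin.natAdd 2 p

/-- In the chart `φ = (y, z)` the metric has the form `γ_{ab} dy^a dy^b + k_{pq} dz^p dz^q`, where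
`γ_{ab}` depends on `y` only, and the subset `T` of `M` is a slice `y = const`, so that the
restriction of `k_{pq} dz^p dz^q` to it is its induced metric. If `T` is a spacelike surface, the
signature of `g` forces `k` to be positive definite and `γ` to be Lorentzian at the points of
`T`, hence near `T`. -/
def LorentzMetric.IsSplitChart (g : LorentzMetric (2 + n) M) (T : Set M)
    (φ : OpenPartialHomeomorph M (Model (2 + n))) : Prop :=
  (∃ γ : (Fin 2 → ℝ) → Matrix (Fin 2) (Fin 2) ℝ, ∀ u ∈ φ.target, ∀ a b,
    g.comp φ u (yIdx a) (yIdx b) = γ (fun c ↦ u (yIdx c)) a b) ∧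
  (∀ u ∈ φ.target, ∀ a p, g.comp φ u (yIdx a) (zIdx p) = 0) ∧
  ∃ y₀ : Fin 2 → ℝ, ∀ x ∈ φ.source, x ∈ T ↔ ∀ a, φ x (yIdx a) = y₀ a

/-- In a neighbourhood of the subset `T` the metric splits as
`γ_{ab} dy^a dy^b + k_{pq} dz^p dz^q`: smooth charts in which it does cover `T`. -/
def LorentzMetric.SplitsNear (g : LorentzMetric (2 + n) M) (T : Set M) : Prop :=
  ∀ x ∈ T, ∃ φ ∈ IsManifold.maximalAtlas (𝓡 (2 + n)) ∞ M, x ∈ φ.source ∧ g.IsSplitChart T φ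

end Splitting

end

/-!
Let `f` be spacetime convex, and let `x` be a point of the compact surface `S` at which `f|_S` is
maximal. In a split chart `(y, z)` around `x` the surface is a slice `y = const`, so at `x` the
derivatives `∂_p f` along `z` vanish and `∂_p ∂_q f` is negative semidefinite
(`partialDeriv_test`). Because the metric has block form, the tangential part of the Hessian is
then `∇_p ∇_q f = ∂_p ∂_q f + ½ G^a ∂_a k_{pq}`, where `G` is the gradient of `f`, which is normal to
`S` at `x` (`LorentzMetric.IsSplitChart.exists_sum_christoffel_mul`).

The expansion of `S` along a normal field `L` is `½ L^a k^{pq} ∂_a k_{pq}`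
(`LorentzMetric.IsSplitChart.expansion_eq`). When it vanishes for two linearly independent normal
fields, `k^{pq} ∂_a k_{pq} = 0` (`LorentzMetric.IsSplitChart.logVolumeDeriv_eq_zero`), so the trace of
the tangential Hessian is `k^{pq} ∂_p ∂_q f ≤ 0`. But convexity gives
`k^{pq} ∇_p ∇_q f ≥ c k^{pq} k_{pq} = c n > 0`, a contradiction.

Only the second-order behaviour of `f` at the single point `x` is used: no integration over `S` enters.
-/

/-! ### Linear algebra of signatures and traces -/

/-- A Lorentzian form is nondegenerate: the inertia indices leave no room for a radical. -/
lemma IsLorentzianForm.eq_zero_of_forall_eq_zero {V : Type*} [AddCommGroup V] [Module ℝ V]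
    [FiniteDimensional ℝ V] {B : LinearMap.BilinForm ℝ V} (hB : ∀ v w, B v w = B w v)
    (h : IsLorentzianForm (LinearMap.BilinMap.toQuadraticMap B)) {v : V}
    (hv : ∀ w, B v w = 0) : v = 0 := by
  have h1 := QuadraticForm.sigPos_add_sigNeg_add_radical
    (Q := (LinearMap.BilinMap.toQuadraticMap B))
  have h2 : Module.finrank ℝ (LinearMap.BilinMap.toQuadraticMap B).radical = 0 := by
    have := h.1; have := h.2; omega
  have h3 := Submodule.finrank_eq_zero.1 h2
  have h4 : v ∈ (LinearMap.BilinMap.toQuadraticMap B).radical := by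
    rw [QuadraticMap.mem_radical_iff']
    refine ⟨by simp [hv], fun w ↦ ?_⟩
    simp [hv, hB w v]
  simpa [h3] using h4

/-- The trace of a nonnegative bilinear form `X` (not assumed symmetric) with respect to a positive
definite metric `K` is nonnegative. -/
lemma Matrix.PosDef.sum_inv_mul_nonneg {n : ℕ} {K : Matrix (Fin n) (Fin n) ℝ} (hK : K.PosDef)
    (X : Matrix (Fin n) (Fin n) ℝ) (hX : ∀ v : Fin n → ℝ, 0 ≤ ∑ p, ∑ q, X p q * v p * v q) :
    0 ≤ ∑ p, ∑ q, K⁻¹ p q * X p q := by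
  obtain ⟨m, v, hv⟩ := Matrix.posSemidef_iff_eq_sum_vecMulVec.1 hK.inv.posSemidef
  have : ∑ p, ∑ q, K⁻¹ p q * X p q = ∑ i, ∑ p, ∑ q, X p q * v i p * v i q := by
    symm
    rw [hv, Finset.sum_comm]
    refine Finset.sum_congr rfl fun p _ ↦ ?_
    rw [Finset.sum_comm]
    refine Finset.sum_congr rfl fun q _ ↦ ?_
    rw [Matrix.sum_apply, Finset.sum_mul]
    refine Finset.sum_congr rfl fun i _ ↦ ?_
    simp only [Matrix.vecMulVec_apply, star_trivial]; ring
  rw [this]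
  exact Finset.sum_nonneg fun i _ ↦ hX (v i)

lemma Matrix.sum_inv_mul_self {n : ℕ} {K : Matrix (Fin n) (Fin n) ℝ} (hK : K.PosDef) :
    ∑ p, ∑ q, K⁻¹ p q * K p q = n := by
  have h1 : K⁻¹ * K = 1 := Matrix.nonsing_inv_mul _ ((Matrix.isUnit_iff_isUnit_det _).1 hK.isUnit)
  have hs : ∀ p q, K p q = K q p := fun p q ↦ by simpa using hK.1.apply q p
  have h2 := congrArg Matrix.trace h1
  simp only [Matrix.trace, Matrix.diag, Matrix.mul_apply, Matrix.one_apply_eq] at h2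
  simp_rw [hs _ _] at h2 ⊢
  simpa using h2

/-- If `A * K * Aᵀ` is the Gram matrix of the frame with coefficients `A`, this expresses the
inverse metric `K⁻¹` through the inverse Gram matrix. -/
lemma Matrix.transpose_mul_inv_mul {n : ℕ} {K A : Matrix (Fin n) (Fin n) ℝ} (hA : IsUnit A) :
    Aᵀ * (A * K * Aᵀ)⁻¹ * A = K⁻¹ := by
  have hd := (Matrix.isUnit_iff_isUnit_det _).1 hA
  have hd' : IsUnit Aᵀ.det := by rwa [Matrix.det_transpose]
  rw [Matrix.mul_inv_rev, Matrix.mul_inv_rev, ← Matrix.mul_assoc, Matrix.mul_nonsing_inv _ hd',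
    Matrix.one_mul, Matrix.mul_assoc, Matrix.nonsing_inv_mul _ hd, Matrix.mul_one]

/-- The change-of-frame formula for the trace of a bilinear form `X` with respect to `H`. -/
lemma Matrix.sum_mul_sum_sum {n : ℕ} (H A X : Matrix (Fin n) (Fin n) ℝ) :
    ∑ i, ∑ j, H i j * ∑ p, ∑ q, A i p * A j q * X p q = ∑ p, ∑ q, (Aᵀ * H * A) p q * X p q := by
  simp only [Matrix.mul_apply, Matrix.transpose_apply, Finset.mul_sum, Finset.sum_mul]
  calc _ = ∑ i, ∑ p, ∑ j, ∑ q, H i j * (A i p * A j q * X p q) :=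
        Finset.sum_congr rfl fun i _ ↦ Finset.sum_comm
    _ = ∑ p, ∑ i, ∑ j, ∑ q, H i j * (A i p * A j q * X p q) := Finset.sum_comm
    _ = ∑ p, ∑ i, ∑ q, ∑ j, H i j * (A i p * A j q * X p q) :=
        Finset.sum_congr rfl fun p _ ↦ Finset.sum_congr rfl fun i _ ↦ Finset.sum_comm
    _ = ∑ p, ∑ q, ∑ i, ∑ j, H i j * (A i p * A j q * X p q) :=
        Finset.sum_congr rfl fun p _ ↦ Finset.sum_comm
    _ = _ := Finset.sum_congr rfl fun p _ ↦ Finset.sum_congr rfl fun q _ ↦ by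
        rw [Finset.sum_comm]
        exact Finset.sum_congr rfl fun j _ ↦ Finset.sum_congr rfl fun i _ ↦ by ring

/-! ### Second-order conditions at a maximum -/

lemma deriv_deriv_nonpos_of_isLocalMax {F : ℝ → ℝ} {t : ℝ} (h : IsLocalMax F t)
    (hc : ContinuousAt F t) : deriv (deriv F) t ≤ 0 := by
  by_contra! h2
  have h3 := isLocalMin_of_deriv_deriv_pos h2 h.deriv_eq_zero hc
  have h4 : F =ᶠ[nhds t] fun _ ↦ F t := by
    filter_upwards [h, h3] with x h5 h6 using le_antisymm h5 h6
  have h5 := (h4.deriv).deriv_eq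
  simp at h5
  exact h2.ne' h5

lemma fderiv_eq_sum_partialDeriv {d : ℕ} (F : Model d → ℝ) (u e : Model d) :
    fderiv ℝ F u e = ∑ μ, e μ * partialDeriv μ F u := by
  conv_lhs => rw [← (EuclideanSpace.basisFun (Fin d) ℝ).sum_repr e]
  simp [partialDeriv, coordVec]

/-- First- and second-order necessary conditions at a point where `F` is maximal along the line in
the direction `e`, in terms of partial derivatives. -/
lemma partialDeriv_test {d : ℕ} {F : Model d → ℝ} {u : Model d} (hF : ContDiffAt ℝ 2 F u)
    (e : Model d) (hmax : IsLocalMax (fun t : ℝ ↦ F (u + t • e)) 0) :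
    ∑ μ, e μ * partialDeriv μ F u = 0 ∧
    ∑ μ, ∑ ν, partialDeriv μ (partialDeriv ν F) u * e μ * e ν ≤ 0 := by
  have hl : ∀ t : ℝ, HasDerivAt (fun t : ℝ ↦ u + t • e) e t := fun t ↦ by
    simpa using ((hasDerivAt_id t).smul_const e).const_add u
  have hl0 : Filter.Tendsto (fun t : ℝ ↦ u + t • e) (nhds 0) (nhds u) := by
    simpa using (hl 0).continuousAt.tendsto
  have hd : ∀ᶠ t : ℝ in nhds 0,
      HasDerivAt (fun t : ℝ ↦ F (u + t • e)) (fderiv ℝ F (u + t • e) e) t := by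
    have h1 : ∀ᶠ u' in nhds u, ContDiffAt ℝ 2 F u' := hF.eventually (by simp)
    filter_upwards [hl0.eventually h1] with t ht
    exact ((ht.differentiableAt (by simp)).hasFDerivAt).comp_hasDerivAt t (hl t)
  have hd0 := hd.self_of_nhds
  have h1 := hmax.hasDerivAt_eq_zero hd0
  simp only [zero_smul, add_zero] at h1
  refine ⟨by rw [← h1, fderiv_eq_sum_partialDeriv], ?_⟩
  have h2 := deriv_deriv_nonpos_of_isLocalMax hmax hd0.continuousAt
  have h3 : deriv (fun t : ℝ ↦ F (u + t • e)) =ᶠ[nhds 0]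
      fun t ↦ ∑ ν, e ν * partialDeriv ν F (u + t • e) := by
    filter_upwards [hd] with t ht
    rw [ht.deriv, fderiv_eq_sum_partialDeriv]
  have hdF : DifferentiableAt ℝ (fderiv ℝ F) u :=
    (hF.fderiv_right (m := 1) (by norm_num)).differentiableAt (by simp)
  have h4 : ∀ ν, HasDerivAt (fun t : ℝ ↦ partialDeriv ν F (u + t • e))
      (fderiv ℝ (partialDeriv ν F) u e) 0 := fun ν ↦ by
    have h5 : DifferentiableAt ℝ (partialDeriv ν F) u := hdF.clm_apply (by fun_prop)
    have h6 : HasFDerivAt (partialDeriv ν F) (fderiv ℝ (partialDeriv ν F) u)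
      (u + (0 : ℝ) • e) := by simpa using h5.hasFDerivAt
    exact h6.comp_hasDerivAt 0 (hl 0)
  rw [h3.deriv_eq, (HasDerivAt.fun_sum fun ν _ ↦ (h4 ν).const_mul (e ν)).deriv] at h2
  refine le_of_eq_of_le ?_ h2
  rw [Finset.sum_comm]
  refine Finset.sum_congr rfl fun ν _ ↦ ?_
  rw [fderiv_eq_sum_partialDeriv, Finset.mul_sum]
  exact Finset.sum_congr rfl fun μ _ ↦ by ring

/-! ### Components of vectors and of the metric in a chart -/

section Components

variable {d : ℕ} {M : Type*} [TopologicalSpace M] [ChartedSpace (Model d) M]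
  {φ : OpenPartialHomeomorph M (Model d)}

lemma mdifferentiable_of_mem_maximalAtlas
    (hφ : φ ∈ IsManifold.maximalAtlas (𝓡 d) ∞ M) : φ.MDifferentiable (𝓡 d) (𝓡 d) :=
  ⟨(contMDiffOn_of_mem_maximalAtlas hφ).mdifferentiableOn (by simp),
    (contMDiffOn_symm_of_mem_maximalAtlas hφ).mdifferentiableOn (by simp)⟩

lemma vecComp_coordField (hφ : φ ∈ IsManifold.maximalAtlas (𝓡 d) ∞ M) {u : Model d}
    (hu : u ∈ φ.target) (μ ν : Fin d) :
    vecComp φ (φ.symm u) (coordField φ μ u) ν = if ν = μ then 1 else 0 := by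
  have h := congrArg (fun A ↦ A (coordVec μ))
    ((mdifferentiable_of_mem_maximalAtlas hφ).comp_symm_deriv hu)
  have h' : mfderiv (𝓡 d) (𝓡 d) φ (φ.symm u) (coordField φ μ u) = coordVec μ := h
  simp only [vecComp, h']
  exact PiLp.single_apply 2 ℝ μ (1 : ℝ) ν

lemma vecComp_add (x : M) (v w : TangentSpace (𝓡 d) x) (μ : Fin d) :
    vecComp φ x (v + w) μ = vecComp φ x v μ + vecComp φ x w μ := by
  simp only [vecComp, map_add]
  exact map_add (EuclideanSpace.proj μ : Model d →L[ℝ] ℝ) _ _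

lemma vecComp_smul (x : M) (c : ℝ) (v : TangentSpace (𝓡 d) x) (μ : Fin d) :
    vecComp φ x (c • v) μ = c * vecComp φ x v μ := by
  simp only [vecComp, map_smul]
  exact map_smul (EuclideanSpace.proj μ : Model d →L[ℝ] ℝ) _ _

lemma vecComp_zero (x : M) (μ : Fin d) : vecComp φ x 0 μ = 0 := by
  simpa using vecComp_smul (φ := φ) x 0 0 μ

lemma vecComp_sum {α : Type*} (t : Finset α) (x : M) (v : α → TangentSpace (𝓡 d) x) (μ : Fin d) :
    vecComp φ x (∑ i ∈ t, v i) μ = ∑ i ∈ t, vecComp φ x (v i) μ := by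
  simp only [vecComp, map_sum]
  exact map_sum (EuclideanSpace.proj μ : Model d →L[ℝ] ℝ) _ _

lemma eq_of_vecComp_eq (hφ : φ ∈ IsManifold.maximalAtlas (𝓡 d) ∞ M) {x : M} (hx : x ∈ φ.source)
    {v w : TangentSpace (𝓡 d) x} (h : ∀ μ, vecComp φ x v μ = vecComp φ x w μ) : v = w := by
  refine (mdifferentiable_of_mem_maximalAtlas hφ).mfderiv_injective hx ?_
  exact PiLp.ext h

lemma sum_vecComp_smul_coordField (hφ : φ ∈ IsManifold.maximalAtlas (𝓡 d) ∞ M) {u : Model d}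
    (hu : u ∈ φ.target) (v : TangentSpace (𝓡 d) (φ.symm u)) :
    ∑ μ, vecComp φ (φ.symm u) v μ • coordField φ μ u = v := by
  refine eq_of_vecComp_eq hφ (φ.map_target hu) fun ν ↦ ?_
  simp [vecComp_sum, vecComp_smul, vecComp_coordField hφ hu]

namespace LorentzMetric

variable [IsManifold (𝓡 d) ∞ M] (g : LorentzMetric d M)

lemma inner_eq_sum_comp (hφ : φ ∈ IsManifold.maximalAtlas (𝓡 d) ∞ M) {x : M} {u : Model d}
    (hu : u ∈ φ.target) (hx : φ.symm u = x) (v w : TangentSpace (𝓡 d) x) :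
    g.inner x v w = ∑ μ, ∑ ν, g.comp φ u μ ν * vecComp φ x v μ * vecComp φ x w ν := by
  subst hx
  conv_lhs => rw [← sum_vecComp_smul_coordField hφ hu v, ← sum_vecComp_smul_coordField hφ hu w]
  simp only [map_sum, map_smul, FunLike.coe_sum, Finset.sum_apply, FunLike.coe_smul,
    Pi.smul_apply, smul_eq_mul, comp, Matrix.of_apply, Finset.mul_sum]
  rw [Finset.sum_comm]
  exact Finset.sum_congr rfl fun μ _ ↦ Finset.sum_congr rfl fun ν _ ↦ by ring

lemma comp_symm (u : Model d) (μ ν : Fin d) : g.comp φ u μ ν = g.comp φ u ν μ :=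
  g.symm _ _ _

lemma isUnit_det_comp (hφ : φ ∈ IsManifold.maximalAtlas (𝓡 d) ∞ M) {u : Model d}
    (hu : u ∈ φ.target) : IsUnit (g.comp φ u).det := by
  rw [← Matrix.isUnit_iff_isUnit_det, ← Matrix.vecMul_injective_iff_isUnit]
  refine (injective_iff_map_eq_zero (Matrix.vecMulLinear (g.comp φ u))).2 fun c hc ↦ ?_
  have hc' : c ᵥ* g.comp φ u = 0 := hc
  set v : TangentSpace (𝓡 d) (φ.symm u) := ∑ μ, c μ • coordField φ μ u with hv
  have hvc : ∀ μ, vecComp φ _ v μ = c μ := fun μ ↦ by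
    simp [hv, vecComp_sum, vecComp_smul, vecComp_coordField hφ hu]
  have hv0 : v = 0 := by
    have : FiniteDimensional ℝ (TangentSpace (𝓡 d) (φ.symm u)) :=
      inferInstanceAs (FiniteDimensional ℝ (Model d))
    refine (g.lorentzian (φ.symm u)).eq_zero_of_forall_eq_zero
      (fun v w ↦ g.symm _ v w) fun w ↦ ?_
    change g.inner _ v w = 0
    rw [g.inner_eq_sum_comp hφ hu rfl, Finset.sum_comm]
    refine Finset.sum_eq_zero fun ν _ ↦ ?_
    have := congrFun hc' ν
    simp only [Matrix.vecMul, dotProduct, Pi.zero_apply] at this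
    rw [← Finset.sum_mul]
    simp only [hvc, mul_comm (g.comp φ u _ _), this, zero_mul]
  funext μ
  rw [← hvc μ, hv0]
  exact vecComp_zero _ μ

/-- The Christoffel symbols of the first kind. -/
lemma sum_comp_mul_christoffel (hφ : φ ∈ IsManifold.maximalAtlas (𝓡 d) ∞ M) {u : Model d}
    (hu : u ∈ φ.target) (κ μ ν : Fin d) :
    ∑ l, g.comp φ u κ l * g.christoffel φ u l μ ν = (1 / 2) *
      (partialDeriv μ (fun u' ↦ g.comp φ u' ν κ) u + partialDeriv ν (fun u' ↦ g.comp φ u' μ κ) u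
      - partialDeriv κ (fun u' ↦ g.comp φ u' μ ν) u) := by
  set X : Fin d → ℝ := fun σ ↦
    partialDeriv μ (fun u' ↦ g.comp φ u' ν σ) u + partialDeriv ν (fun u' ↦ g.comp φ u' μ σ) u
      - partialDeriv σ (fun u' ↦ g.comp φ u' μ ν) u with hX
  have h1 : g.comp φ u *ᵥ ((g.comp φ u)⁻¹ *ᵥ X) = X := by
    rw [Matrix.mulVec_mulVec, Matrix.mul_nonsing_inv _ (g.isUnit_det_comp hφ hu),
      Matrix.one_mulVec]
  have h2 := congrFun h1 κ
  change _ = (1 / 2) * X κ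
  rw [← h2]
  simp only [Matrix.mulVec, dotProduct, christoffel, Finset.mul_sum]
  exact Finset.sum_congr rfl fun l _ ↦ Finset.sum_congr rfl fun σ _ ↦ by simp only [hX]; ring

end LorentzMetric

section Surface

variable {n : ℕ} {S : Type*} [TopologicalSpace S] [ChartedSpace (Model n) S]
  {ψ : OpenPartialHomeomorph S (Model n)} {ι : S → M}

lemma LorentzMetric.tangentComp_eq_vecComp (hφ : φ ∈ IsManifold.maximalAtlas (𝓡 d) ∞ M)
    (hψ : ψ ∈ IsManifold.maximalAtlas (𝓡 n) ∞ S) (hι : ContMDiff (𝓡 n) (𝓡 d) ∞ ι)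
    {w : Model n} (hw : w ∈ ψ.target) (hx : ι (ψ.symm w) ∈ φ.source) (i : Fin n) (μ : Fin d) :
    tangentComp φ ψ ι w i μ = vecComp φ (ι (ψ.symm w))
      (mfderiv (𝓡 n) (𝓡 d) ι (ψ.symm w) (coordField ψ i w)) μ := by
  have h1 := ((mdifferentiable_of_mem_maximalAtlas hψ).mdifferentiableAt_symm hw).hasMFDerivAt
  have h2 := (hι.mdifferentiableAt (x := ψ.symm w) (by simp)).hasMFDerivAt
  have h3 := ((mdifferentiable_of_mem_maximalAtlas hφ).mdifferentiableAt hx).hasMFDerivAt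
  have h4 := ((h3.comp (ψ.symm w) h2).comp w h1).hasFDerivAt
  have h5 := ((EuclideanSpace.proj μ : Model d →L[ℝ] ℝ).hasFDerivAt).comp w h4
  exact congrArg (fun A ↦ A (coordVec i)) h5.fderiv

lemma LorentzMetric.vecComp_mfderiv_sum (hφ : φ ∈ IsManifold.maximalAtlas (𝓡 d) ∞ M)
    (hψ : ψ ∈ IsManifold.maximalAtlas (𝓡 n) ∞ S) (hι : ContMDiff (𝓡 n) (𝓡 d) ∞ ι)
    {w : Model n} (hw : w ∈ ψ.target) (hx : ι (ψ.symm w) ∈ φ.source) (c : Fin n → ℝ)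
    (μ : Fin d) :
    vecComp φ (ι (ψ.symm w)) (mfderiv (𝓡 n) (𝓡 d) ι (ψ.symm w)
      (∑ i, c i • coordField ψ i w)) μ = ∑ i, c i * tangentComp φ ψ ι w i μ := by
  simp only [map_sum, map_smul, vecComp_sum, vecComp_smul,
    tangentComp_eq_vecComp hφ hψ hι hw hx]

end Surface

end Components

/-! ### The geometry of the surface in a split chart -/

/-- Near a point of a surface that lies in the domain of a chart `φ`, the surface stays in it. -/
lemma eventually_mem_source {H H' M S : Type*} [TopologicalSpace H] [TopologicalSpace H']
    [TopologicalSpace M] [TopologicalSpace S] {φ : OpenPartialHomeomorph M H}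
    {ψ : OpenPartialHomeomorph S H'} {ι : S → M} (hι : Continuous ι) {w : H'} (hw : w ∈ ψ.target)
    (hx : ι (ψ.symm w) ∈ φ.source) :
    ∀ᶠ w' in nhds w, w' ∈ ψ.target ∧ ι (ψ.symm w') ∈ φ.source :=
  Filter.Eventually.and (ψ.open_target.mem_nhds hw) <|
    (hι.continuousAt.comp (ψ.continuousAt_symm hw)).eventually (φ.open_source.mem_nhds hx)

noncomputable section

section Split

variable {n : ℕ} {M : Type*} [TopologicalSpace M] [ChartedSpace (Model (2 + n)) M]
  {S : Type*} [TopologicalSpace S]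
  {φ : OpenPartialHomeomorph M (Model (2 + n))} {ψ : OpenPartialHomeomorph S (Model n)} {ι : S → M}

/-- The components `E_i^p` of the tangent frame of the surface along the coordinates `z^p`. -/
def tangentFrame (φ : OpenPartialHomeomorph M (Model (2 + n)))
    (ψ : OpenPartialHomeomorph S (Model n)) (ι : S → M) (w : Model n) :
    Matrix (Fin n) (Fin n) ℝ :=
  Matrix.of fun i p ↦ LorentzMetric.tangentComp φ ψ ι w i (zIdx p)

namespace LorentzMetric

variable [IsManifold (𝓡 (2 + n)) ∞ M] {g : LorentzMetric (2 + n) M}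

/-- The block `k_{pq} = g(∂_{z^p}, ∂_{z^q})` of the components of the metric. -/
def zComp (g : LorentzMetric (2 + n) M) (φ : OpenPartialHomeomorph M (Model (2 + n)))
    (u : Model (2 + n)) : Matrix (Fin n) (Fin n) ℝ :=
  Matrix.of fun p q ↦ g.comp φ u (zIdx p) (zIdx q)

/-- The derivatives `∂_a k_{pq}` of the components of the `z` block of the metric. -/
def zCompDeriv (g : LorentzMetric (2 + n) M) (φ : OpenPartialHomeomorph M (Model (2 + n)))
    (u : Model (2 + n)) (a : Fin 2) : Matrix (Fin n) (Fin n) ℝ :=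
  Matrix.of fun p q ↦ partialDeriv (yIdx a) (fun u' ↦ g.comp φ u' (zIdx p) (zIdx q)) u

/-- The trace `k^{pq} ∂_a k_{pq}`, that is, twice the logarithmic derivative of the volume density
`√(det k)` of the slices in the direction `y^a`. -/
def logVolumeDeriv (g : LorentzMetric (2 + n) M) (φ : OpenPartialHomeomorph M (Model (2 + n)))
    (u : Model (2 + n)) (a : Fin 2) : ℝ :=
  ∑ p, ∑ q, (g.zComp φ u)⁻¹ p q * g.zCompDeriv φ u a p q

lemma sum_zComp_inv_mul_sum (g : LorentzMetric (2 + n) M) (u : Model (2 + n)) (c : Fin 2 → ℝ) :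
    ∑ p, ∑ q, (g.zComp φ u)⁻¹ p q * ((1 / 2) * ∑ a, c a * g.zCompDeriv φ u a p q) =
    (1 / 2) * ∑ a, c a * g.logVolumeDeriv φ u a := by
  simp only [logVolumeDeriv, Finset.mul_sum]
  rw [Finset.sum_comm_cycle]
  exact Finset.sum_congr rfl fun a _ ↦ Finset.sum_congr rfl fun p _ ↦
    Finset.sum_congr rfl fun q _ ↦ by ring

section Blocks

variable {T : Set M}

lemma IsSplitChart.comp_yIdx_zIdx (h : g.IsSplitChart T φ) {u : Model (2 + n)}
    (hu : u ∈ φ.target) (a : Fin 2) (p : Fin n) : g.comp φ u (yIdx a) (zIdx p) = 0 :=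
  h.2.1 u hu a p

lemma IsSplitChart.comp_zIdx_yIdx (h : g.IsSplitChart T φ) {u : Model (2 + n)}
    (hu : u ∈ φ.target) (p : Fin n) (a : Fin 2) : g.comp φ u (zIdx p) (yIdx a) = 0 :=
  (g.comp_symm u _ _).trans (h.2.1 u hu a p)

lemma IsSplitChart.partialDeriv_comp_yIdx_zIdx (h : g.IsSplitChart T φ) {u : Model (2 + n)}
    (hu : u ∈ φ.target) (μ : Fin (2 + n)) (a : Fin 2) (p : Fin n) :
    partialDeriv μ (fun u' ↦ g.comp φ u' (yIdx a) (zIdx p)) u = 0 := by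
  have : (fun u' ↦ g.comp φ u' (yIdx a) (zIdx p)) =ᶠ[nhds u] fun _ ↦ 0 := by
    filter_upwards [φ.open_target.mem_nhds hu] with u' hu' using h.comp_yIdx_zIdx hu' a p
  simp [partialDeriv, this.fderiv_eq]

lemma IsSplitChart.partialDeriv_comp_zIdx_yIdx (h : g.IsSplitChart T φ) {u : Model (2 + n)}
    (hu : u ∈ φ.target) (μ : Fin (2 + n)) (p : Fin n) (a : Fin 2) :
    partialDeriv μ (fun u' ↦ g.comp φ u' (zIdx p) (yIdx a)) u = 0 := by
  simp_rw [fun u' ↦ g.comp_symm (φ := φ) u' (zIdx p) (yIdx a)]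
  exact h.partialDeriv_comp_yIdx_zIdx hu μ a p

/-- For a covector `β` that annihilates the slice `y = const`, the contraction `Γ^l_{pq} β_l` is the
second fundamental form of the slice in the direction `G` dual to `β`: the block form of the metric
leaves only the terms `-½ G^a ∂_a k_{pq}`. -/
lemma IsSplitChart.exists_sum_christoffel_mul (h : g.IsSplitChart T φ)
    (hφ : φ ∈ IsManifold.maximalAtlas (𝓡 (2 + n)) ∞ M) {u : Model (2 + n)}
    (hu : u ∈ φ.target) (hk : (g.zComp φ u).PosDef) {β : Fin (2 + n) → ℝ}
    (hβ : ∀ p, β (zIdx p) = 0) :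
    ∃ G : Fin 2 → ℝ, ∀ p q, ∑ l, g.christoffel φ u l (zIdx p) (zIdx q) * β l =
      - (1 / 2) * ∑ a, G a * g.zCompDeriv φ u a p q := by
  set G := β ᵥ* (g.comp φ u)⁻¹ with hG
  have h1 : G ᵥ* g.comp φ u = β := by
    rw [hG, Matrix.vecMul_vecMul, Matrix.nonsing_inv_mul _ (g.isUnit_det_comp hφ hu),
      Matrix.vecMul_one]
  have h2 : ∀ p, G (zIdx p) = 0 := by
    refine congrFun (Matrix.vecMul_injective_of_isUnit hk.isUnit
      (a₁ := fun p ↦ G (zIdx p)) (a₂ := 0) ?_)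
    funext q
    have h3 := congrFun h1 (zIdx q)
    simpa [Matrix.vecMul, dotProduct, Fin.sum_univ_add, h.2.1 u hu, hβ, zComp] using h3
  refine ⟨fun a ↦ G (yIdx a), fun p q ↦ ?_⟩
  set X : Fin (2 + n) → ℝ := fun σ ↦
    partialDeriv (zIdx p) (fun u' ↦ g.comp φ u' (zIdx q) σ) u +
      partialDeriv (zIdx q) (fun u' ↦ g.comp φ u' (zIdx p) σ) u
      - partialDeriv σ (fun u' ↦ g.comp φ u' (zIdx p) (zIdx q)) u with hX
  have h4 : ∑ l, g.christoffel φ u l (zIdx p) (zIdx q) * β l = (1 / 2) * ∑ σ, G σ * X σ := by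
    simp only [hG, Matrix.vecMul, dotProduct, christoffel, Finset.mul_sum, Finset.sum_mul]
    rw [Finset.sum_comm]
    exact Finset.sum_congr rfl fun σ _ ↦ Finset.sum_congr rfl fun l _ ↦ by simp only [hX]; ring
  rw [h4, Fin.sum_univ_add]
  simp only [h2, zero_mul, Finset.sum_const_zero, add_zero, hX,
    h.partialDeriv_comp_zIdx_yIdx hu, zero_sub, mul_neg, Finset.sum_neg_distrib, neg_mul, zCompDeriv,
    Matrix.of_apply]

end Blocks

section Surface

/-- The coordinates `y^a` are constant along the surface. -/
lemma IsSplitChart.tangentComp_yIdx (h : g.IsSplitChart (Set.range ι) φ) (hι : Continuous ι)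
    {w : Model n} (hw : w ∈ ψ.target) (hx : ι (ψ.symm w) ∈ φ.source) (i : Fin n) (a : Fin 2) :
    tangentComp φ ψ ι w i (yIdx a) = 0 := by
  obtain ⟨y₀, hy⟩ := h.2.2
  have : (fun w' ↦ φ (ι (ψ.symm w')) (yIdx a)) =ᶠ[nhds w] fun _ ↦ y₀ a := by
    filter_upwards [eventually_mem_source hι hw hx] with w' hw'
    exact (hy _ hw'.2).1 ⟨_, rfl⟩ a
  simp [tangentComp, partialDeriv, this.fderiv_eq]

lemma IsSplitChart.inducedComp_eq (h : g.IsSplitChart (Set.range ι) φ) (hι : Continuous ι)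
    {w : Model n} (hw : w ∈ ψ.target) (hx : ι (ψ.symm w) ∈ φ.source) :
    g.inducedComp φ ψ ι w = tangentFrame φ ψ ι w * g.zComp φ (φ (ι (ψ.symm w))) *
      (tangentFrame φ ψ ι w)ᵀ := by
  ext i j
  simp only [inducedComp, Matrix.of_apply, Fin.sum_univ_add, h.tangentComp_yIdx hι hw hx,
    mul_zero, zero_mul, Finset.sum_const_zero, zero_add, Matrix.mul_apply, Finset.sum_mul,
    Matrix.transpose_apply, zComp, tangentFrame]
  rw [Finset.sum_comm]
  exact Finset.sum_congr rfl fun p _ ↦ Finset.sum_congr rfl fun q _ ↦ by ring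

variable [ChartedSpace (Model n) S]

lemma IsSplitChart.isUnit_tangentFrame (h : g.IsSplitChart (Set.range ι) φ)
    (hφ : φ ∈ IsManifold.maximalAtlas (𝓡 (2 + n)) ∞ M)
    (hψ : ψ ∈ IsManifold.maximalAtlas (𝓡 n) ∞ S) (hι : ContMDiff (𝓡 n) (𝓡 (2 + n)) ∞ ι)
    (hS : g.IsSpacelike (n := n) ι)
    {w : Model n} (hw : w ∈ ψ.target) (hx : ι (ψ.symm w) ∈ φ.source) :
    IsUnit (tangentFrame φ ψ ι w) := by
  rw [← Matrix.vecMul_injective_iff_isUnit]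
  refine (injective_iff_map_eq_zero (Matrix.vecMulLinear (tangentFrame φ ψ ι w))).2 fun c hc ↦ ?_
  have hc' : c ᵥ* tangentFrame φ ψ ι w = 0 := hc
  set v : TangentSpace (𝓡 n) (ψ.symm w) := ∑ i, c i • coordField ψ i w with hv
  have h0 : mfderiv (𝓡 n) (𝓡 (2 + n)) ι (ψ.symm w) v = 0 := by
    refine eq_of_vecComp_eq hφ hx fun μ ↦ ?_
    rw [hv, vecComp_mfderiv_sum hφ hψ hι hw hx, vecComp_zero]
    refine Fin.addCases (fun a ↦ ?_) (fun p ↦ ?_) μ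
    · exact Finset.sum_eq_zero fun i _ ↦ by rw [h.tangentComp_yIdx hι.continuous hw hx, mul_zero]
    · exact congrFun hc' p
  have hv0 : v = 0 := by
    by_contra hne
    have := hS _ v hne
    rw [h0] at this
    simp at this
  funext i
  have h1 : vecComp ψ (ψ.symm w) v i = c i := by
    simp [hv, vecComp_sum, vecComp_smul, vecComp_coordField hψ hw]
  rw [← h1, hv0]
  exact vecComp_zero _ i

/-- In a split chart, the tangent spaces of the surface are spanned by the `∂_{z^p}`. -/
lemma IsSplitChart.exists_mfderiv_eq (h : g.IsSplitChart (Set.range ι) φ)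
    (hφ : φ ∈ IsManifold.maximalAtlas (𝓡 (2 + n)) ∞ M)
    (hψ : ψ ∈ IsManifold.maximalAtlas (𝓡 n) ∞ S) (hι : ContMDiff (𝓡 n) (𝓡 (2 + n)) ∞ ι)
    (hS : g.IsSpacelike (n := n) ι)
    {w : Model n} (hw : w ∈ ψ.target) (hx : ι (ψ.symm w) ∈ φ.source) (z : Fin n → ℝ) :
    ∃ v : TangentSpace (𝓡 n) (ψ.symm w),
      (∀ a, vecComp φ (ι (ψ.symm w)) (mfderiv (𝓡 n) (𝓡 (2 + n)) ι (ψ.symm w) v) (yIdx a) = 0) ∧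
      ∀ p, vecComp φ (ι (ψ.symm w)) (mfderiv (𝓡 n) (𝓡 (2 + n)) ι (ψ.symm w) v) (zIdx p) = z p := by
  obtain ⟨c, hc⟩ := (Matrix.vecMul_surjective_iff_isUnit.2
    (h.isUnit_tangentFrame hφ hψ hι hS hw hx)) z
  refine ⟨∑ i, c i • coordField ψ i w, fun a ↦ ?_, fun p ↦ ?_⟩
  · rw [vecComp_mfderiv_sum hφ hψ hι hw hx]
    exact Finset.sum_eq_zero fun i _ ↦ by rw [h.tangentComp_yIdx hι.continuous hw hx, mul_zero]
  · rw [vecComp_mfderiv_sum hφ hψ hι hw hx]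
    exact congrFun hc p

lemma IsSplitChart.posDef_zComp (h : g.IsSplitChart (Set.range ι) φ)
    (hφ : φ ∈ IsManifold.maximalAtlas (𝓡 (2 + n)) ∞ M)
    (hψ : ψ ∈ IsManifold.maximalAtlas (𝓡 n) ∞ S) (hι : ContMDiff (𝓡 n) (𝓡 (2 + n)) ∞ ι)
    (hS : g.IsSpacelike (n := n) ι)
    {w : Model n} (hw : w ∈ ψ.target) (hx : ι (ψ.symm w) ∈ φ.source) :
    (g.zComp φ (φ (ι (ψ.symm w)))).PosDef := by
  refine Matrix.PosDef.of_dotProduct_mulVec_pos ?_ fun z hz ↦ ?_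
  · exact Matrix.IsHermitian.ext fun p q ↦ g.comp_symm _ _ _
  · obtain ⟨v, hv1, hv2⟩ := h.exists_mfderiv_eq hφ hψ hι hS hw hx z
    have hv0 : v ≠ 0 := by
      rintro rfl
      refine hz (funext fun p ↦ ?_)
      rw [← hv2 p, map_zero]
      exact vecComp_zero _ _
    have h1 := hS _ v hv0
    rw [g.inner_eq_sum_comp hφ (φ.map_source hx) (φ.left_inv hx)] at h1
    simp only [Fin.sum_univ_add, hv1, hv2, mul_zero, zero_mul, Finset.sum_const_zero,
      zero_add] at h1
    refine h1.trans_eq ?_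
    simp only [dotProduct, Matrix.mulVec, Finset.mul_sum, zComp, Matrix.of_apply, star_trivial]
    exact Finset.sum_congr rfl fun p _ ↦ Finset.sum_congr rfl fun q _ ↦ by ring

/-- A normal vector of the surface has no `z` components. -/
lemma IsSplitChart.vecComp_zIdx_eq_zero (h : g.IsSplitChart (Set.range ι) φ)
    (hφ : φ ∈ IsManifold.maximalAtlas (𝓡 (2 + n)) ∞ M)
    (hψ : ψ ∈ IsManifold.maximalAtlas (𝓡 n) ∞ S) (hι : ContMDiff (𝓡 n) (𝓡 (2 + n)) ∞ ι)
    (hS : g.IsSpacelike (n := n) ι)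
    {w : Model n} (hw : w ∈ ψ.target) (hx : ι (ψ.symm w) ∈ φ.source)
    {ℓ : TangentSpace (𝓡 (2 + n)) (ι (ψ.symm w))}
    (hℓ : ∀ v : TangentSpace (𝓡 n) (ψ.symm w),
      g.inner (ι (ψ.symm w)) ℓ (mfderiv (𝓡 n) (𝓡 (2 + n)) ι (ψ.symm w) v) = 0) (p : Fin n) :
    vecComp φ (ι (ψ.symm w)) ℓ (zIdx p) = 0 := by
  obtain ⟨v, hv1, hv2⟩ := h.exists_mfderiv_eq hφ hψ hι hS hw hx
    fun p ↦ vecComp φ (ι (ψ.symm w)) ℓ (zIdx p)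
  have h1 := hℓ v
  have hk := h.posDef_zComp hφ hψ hι hS hw hx
  rw [g.inner_eq_sum_comp hφ (φ.map_source hx) (φ.left_inv hx)] at h1
  simp only [Fin.sum_univ_add, hv1, hv2, mul_zero, Finset.sum_const_zero,
    zero_add, h.comp_yIdx_zIdx (φ.map_source hx), zero_mul] at h1
  by_contra hne
  have h2 := hk.dotProduct_mulVec_pos (x := fun p ↦ vecComp φ (ι (ψ.symm w)) ℓ (zIdx p))
    fun h0 ↦ hne (congrFun h0 p)
  refine h2.ne' (Eq.trans ?_ h1)
  simp only [dotProduct, Matrix.mulVec, Finset.mul_sum, zComp, Matrix.of_apply, star_trivial]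
  exact Finset.sum_congr rfl fun p _ ↦ Finset.sum_congr rfl fun q _ ↦ by ring

/-- The expansion of the surface along `L` is half of the trace `L^a k^{pq} ∂_a k_{pq}`. As `L` has no
`z` components along the surface, the derivatives `∂_i L^l` do not contribute. -/
lemma IsSplitChart.expansion_eq (h : g.IsSplitChart (Set.range ι) φ)
    (hφ : φ ∈ IsManifold.maximalAtlas (𝓡 (2 + n)) ∞ M)
    (hψ : ψ ∈ IsManifold.maximalAtlas (𝓡 n) ∞ S) (hι : ContMDiff (𝓡 n) (𝓡 (2 + n)) ∞ ι)
    (hS : g.IsSpacelike (n := n) ι)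
    {w : Model n} (hw : w ∈ ψ.target) (hx : ι (ψ.symm w) ∈ φ.source) {W : Set S} (hW : IsOpen W)
    (hwW : ψ.symm w ∈ W) {L : ∀ s : S, TangentSpace (𝓡 (2 + n)) (ι s)}
    (hL : g.IsNullNormalOn (n := n) ι W L) :
    g.expansion φ ψ ι L w = (1 / 2) * ∑ a : Fin 2, vecComp φ (ι (ψ.symm w)) (L (ψ.symm w)) (yIdx a) *
      g.logVolumeDeriv φ (φ (ι (ψ.symm w))) a := by
  have hu : φ (ι (ψ.symm w)) ∈ φ.target := φ.map_source hx
  set u := φ (ι (ψ.symm w)) with hu_def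
  set ℓ := vecComp φ (ι (ψ.symm w)) (L (ψ.symm w)) with hℓ
  set E := tangentFrame φ ψ ι w with hE
  have hLz : ∀ p, ∀ᶠ w' in nhds w, vecComp φ (ι (ψ.symm w')) (L (ψ.symm w')) (zIdx p) = 0 := by
    intro p
    filter_upwards [eventually_mem_source hι.continuous hw hx,
      (ψ.continuousAt_symm hw).eventually (hW.mem_nhds hwW)] with w' hw' hw'W
    exact h.vecComp_zIdx_eq_zero hφ hψ hι hS hw'.1 hw'.2 (hL.2 _ hw'W).2.2 p
  have hdL : ∀ i p, partialDeriv i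
      (fun w' ↦ vecComp φ (ι (ψ.symm w')) (L (ψ.symm w')) (zIdx p)) w = 0 := by
    intro i p
    have : (fun w' ↦ vecComp φ (ι (ψ.symm w')) (L (ψ.symm w')) (zIdx p)) =ᶠ[nhds w]
      fun _ ↦ 0 := hLz p
    simp [partialDeriv, this.fderiv_eq]
  have hℓz : ∀ p, ℓ (zIdx p) = 0 := fun p ↦ (hLz p).self_of_nhds
  -- The left-hand side is `g(∇_i L, E_j)`.
  have key : ∀ i j, ∑ l, ∑ κ, g.comp φ u l κ * g.covDerivAlong φ ψ ι L w i l *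
      tangentComp φ ψ ι w j κ = ∑ p, ∑ q, E i p * E j q * ((1 / 2) * ∑ a : Fin 2, ℓ (yIdx a) *
        g.zCompDeriv φ u a p q) := by
    intro i j
    have hcov : ∀ q, ∑ l, g.comp φ u (zIdx q) l * g.covDerivAlong φ ψ ι L w i l =
        ∑ p, E i p * ((1 / 2) * ∑ a : Fin 2, ℓ (yIdx a) *
          g.zCompDeriv φ u a p q) := by
      intro q
      have h1 : ∑ l, g.comp φ u (zIdx q) l * partialDeriv i
          (fun w' ↦ vecComp φ (ι (ψ.symm w')) (L (ψ.symm w')) l) w = 0 := by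
        simp [Fin.sum_univ_add, hdL, h.comp_zIdx_yIdx hu]
      have h2 : ∑ l, g.comp φ u (zIdx q) l * ∑ μ, ∑ ν, g.christoffel φ u l μ ν *
          tangentComp φ ψ ι w i μ * ℓ ν = ∑ μ, ∑ ν, (∑ l, g.comp φ u (zIdx q) l *
            g.christoffel φ u l μ ν) * (tangentComp φ ψ ι w i μ * ℓ ν) := by
        simp only [Finset.mul_sum, Finset.sum_mul]
        rw [Finset.sum_comm]
        refine Finset.sum_congr rfl fun μ _ ↦ ?_
        rw [Finset.sum_comm]
        exact Finset.sum_congr rfl fun ν _ ↦ Finset.sum_congr rfl fun l _ ↦ by ring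
      simp only [covDerivAlong, ← hu_def, ← hℓ, mul_add, Finset.sum_add_distrib, h1, h2, zero_add,
        g.sum_comp_mul_christoffel hφ hu]
      simp only [Fin.sum_univ_add, h.tangentComp_yIdx hι.continuous hw hx, hℓz, zero_mul, mul_zero,
        Finset.sum_const_zero, zero_add, add_zero, h.partialDeriv_comp_yIdx_zIdx hu,
        h.partialDeriv_comp_zIdx_yIdx hu, sub_zero]
      simp only [Finset.mul_sum]
      exact Finset.sum_congr rfl fun p _ ↦ Finset.sum_congr rfl fun a _ ↦ by
        simp only [hE, tangentFrame, zCompDeriv, Matrix.of_apply]; ring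
    rw [Finset.sum_comm, Fin.sum_univ_add]
    simp only [h.tangentComp_yIdx hι.continuous hw hx, mul_zero, Finset.sum_const_zero, zero_add,
      ← Finset.sum_mul]
    simp only [g.comp_symm u _ (zIdx _), hcov, Finset.sum_mul]
    rw [Finset.sum_comm]
    exact Finset.sum_congr rfl fun p _ ↦ Finset.sum_congr rfl fun q _ ↦ by
      simp only [hE, tangentFrame, Matrix.of_apply]; ring
  have hinv := Matrix.transpose_mul_inv_mul (K := g.zComp φ u)
    (h.isUnit_tangentFrame hφ hψ hι hS hw hx)
  rw [← h.inducedComp_eq hι.continuous hw hx] at hinv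
  simp only [expansion, ← hu_def, key]
  have h3 := Matrix.sum_mul_sum_sum (g.inducedComp φ ψ ι w)⁻¹ E
    (Matrix.of fun p q ↦ (1 / 2) * ∑ a : Fin 2, ℓ (yIdx a) * g.zCompDeriv φ u a p q)
  rw [hE, hinv] at h3
  exact h3.trans (g.sum_zComp_inv_mul_sum u fun a ↦ ℓ (yIdx a))

/-- If both null expansions vanish, so does the mean curvature covector, as the two null normals span
the normal plane. -/
lemma IsSplitChart.logVolumeDeriv_eq_zero (h : g.IsSplitChart (Set.range ι) φ)
    (hφ : φ ∈ IsManifold.maximalAtlas (𝓡 (2 + n)) ∞ M)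
    (hψ : ψ ∈ IsManifold.maximalAtlas (𝓡 n) ∞ S) (hι : ContMDiff (𝓡 n) (𝓡 (2 + n)) ∞ ι)
    (hS : g.IsSpacelike (n := n) ι) (htrap : g.IsMarginallyInnerOuterTrapped n ι)
    {w : Model n} (hw : w ∈ ψ.target) (hx : ι (ψ.symm w) ∈ φ.source) (a : Fin 2) :
    g.logVolumeDeriv φ (φ (ι (ψ.symm w))) a = 0 := by
  obtain ⟨W, hW, hwW, L, N, hL, hN, hind, hθL, hθN⟩ := htrap (ψ.symm w)
  have e1 := hθL _ hwW φ hφ ψ hψ hx (ψ.map_target hw)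
  have e2 := hθN _ hwW φ hφ ψ hψ hx (ψ.map_target hw)
  rw [ψ.right_inv hw, h.expansion_eq hφ hψ hι hS hw hx hW hwW ‹_›] at e1 e2
  set ℓ : Fin 2 → ℝ := fun a ↦ vecComp φ (ι (ψ.symm w)) (L (ψ.symm w)) (yIdx a) with hℓ
  set ν : Fin 2 → ℝ := fun a ↦ vecComp φ (ι (ψ.symm w)) (N (ψ.symm w)) (yIdx a) with hν
  have hlin : LinearIndependent ℝ ![ℓ, ν] := by
    rw [LinearIndependent.pair_iff]
    intro s t hst
    refine LinearIndependent.pair_iff.1 (hind _ hwW) s t ?_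
    refine eq_of_vecComp_eq hφ hx fun μ ↦ ?_
    rw [vecComp_add, vecComp_smul, vecComp_smul, vecComp_zero]
    refine Fin.addCases (fun a ↦ ?_) (fun p ↦ ?_) μ
    · exact congrFun hst a
    · rw [h.vecComp_zIdx_eq_zero hφ hψ hι hS hw hx (hL.2 _ hwW).2.2,
        h.vecComp_zIdx_eq_zero hφ hψ hι hS hw hx (hN.2 _ hwW).2.2]
      simp
  have hA : IsUnit (Matrix.of ![ℓ, ν]) := Matrix.linearIndependent_rows_iff_isUnit.1 hlin
  refine congrFun (Matrix.mulVec_injective_of_isUnit hA (a₁ := g.logVolumeDeriv φ _) (a₂ := 0) ?_) a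
  funext b
  simp only [Matrix.mulVec_zero, Pi.zero_apply]
  fin_cases b
  · simpa [Matrix.mulVec, dotProduct] using e1
  · simpa [Matrix.mulVec, dotProduct] using e2

end Surface
end LorentzMetric

end Split

end

/-! ### The maximum of the convex function on the surface -/

theorem proposition2 {n : ℕ} (hn : 1 ≤ n)
    {M : Type*} [TopologicalSpace M] [ChartedSpace (Model (2 + n)) M]
    [IsManifold (𝓡 (2 + n)) ∞ M] (g : LorentzMetric (2 + n) M)
    {S : Type*} [TopologicalSpace S] [ChartedSpace (Model n) S] [IsManifold (𝓡 n) ∞ S]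
    [CompactSpace S] [Nonempty S] (ι : S → M)
    (hι : Manifold.IsSmoothEmbedding (𝓡 n) (𝓡 (2 + n)) ∞ ι) (hS : g.IsSpacelike (n := n) ι)
    (hconv : ∃ f : M → ℝ, g.IsSpacetimeConvex f)
    (hsplit : g.SplitsNear (Set.range ι)) :
    ¬ g.IsMarginallyInnerOuterTrapped n ι := by
  intro htrap
  obtain ⟨f, hf, -, c, hc, hconv⟩ := hconv
  obtain ⟨s₀, -, hs₀'⟩ := isCompact_univ.exists_isMaxOn Set.univ_nonempty
    (hf.continuous.comp hι.contMDiff.continuous).continuousOn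
  have hs₀ : ∀ s, f (ι s) ≤ f (ι s₀) := fun s ↦ hs₀' (Set.mem_univ s)
  obtain ⟨φ, hφ, hx, h⟩ := hsplit (ι s₀) ⟨s₀, rfl⟩
  have hψ : chartAt (Model n) s₀ ∈ IsManifold.maximalAtlas (𝓡 n) ∞ S :=
    IsManifold.chart_mem_maximalAtlas s₀
  set ψ := chartAt (Model n) s₀
  have hs : s₀ ∈ ψ.source := mem_chart_source _ s₀
  have hw : ψ s₀ ∈ ψ.target := ψ.map_source hs
  have hx' : ι (ψ.symm (ψ s₀)) ∈ φ.source := by rwa [ψ.left_inv hs]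
  have hk := h.posDef_zComp hφ hψ hι.contMDiff hS hw hx'
  have hT := h.logVolumeDeriv_eq_zero hφ hψ hι.contMDiff hS htrap hw hx'
  rw [ψ.left_inv hs] at hk hT
  have hu : φ (ι s₀) ∈ φ.target := φ.map_source hx
  set u := φ (ι s₀) with hu_def
  set F := f ∘ φ.symm with hF_def
  have hF : ContDiffAt ℝ 2 F u := by
    have := (hf.contMDiffAt (x := φ.symm u)).comp u (contMDiffAt_symm_of_mem_maximalAtlas hφ hu)
    exact this.contDiffAt.of_le (WithTop.coe_le_coe.2 (le_top : (2 : ℕ∞) ≤ ⊤))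
  -- `F` restricted to the slice `y = y(u)` has a local maximum at `u`.
  have test : ∀ v : Fin n → ℝ, ∑ p, v p * partialDeriv (zIdx p) F u = 0 ∧
      ∑ p, ∑ q, partialDeriv (zIdx p) (partialDeriv (zIdx q) F) u * v p * v q ≤ 0 := by
    intro v
    set e : Model (2 + n) := WithLp.toLp 2 (Fin.append 0 v) with he
    have hey : ∀ a : Fin 2, e (yIdx a) = 0 := fun a ↦ by simp [he]
    have hez : ∀ p : Fin n, e (zIdx p) = v p := fun p ↦ by simp [he]
    have hmax : IsLocalMax (fun t : ℝ ↦ F (u + t • e)) 0 := by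
      have hcont : Filter.Tendsto (fun t : ℝ ↦ u + t • e) (nhds 0) (nhds u) := by
        have : Continuous fun t : ℝ ↦ u + t • e := by fun_prop
        simpa using this.tendsto 0
      filter_upwards [hcont.eventually (φ.open_target.mem_nhds hu)] with t ht
      obtain ⟨y₀, hy⟩ := h.2.2
      have h1 : φ.symm (u + t • e) ∈ Set.range ι := by
        refine (hy _ (φ.map_target ht)).2 fun a ↦ ?_
        rw [φ.right_inv ht, ← (hy _ hx).1 ⟨s₀, rfl⟩ a]
        simp [hey, hu_def]
      obtain ⟨s, hs'⟩ := h1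
      have h2 := hs₀ s
      simp only [hF_def, Function.comp_apply, zero_smul, add_zero, ← hs']
      rwa [hu_def, φ.left_inv hx]
    have := partialDeriv_test hF e hmax
    simpa only [Fin.sum_univ_add, hey, hez, zero_mul, mul_zero, Finset.sum_const_zero,
      zero_add] using this
  have hdF : ∀ p, partialDeriv (zIdx p) F u = 0 := fun p ↦ by
    simpa [Pi.single_apply] using (test (Pi.single p 1)).1
  -- The remaining first derivatives `∂_a F` enter the tangential Hessian through the second
  -- fundamental form only.
  obtain ⟨G, hG⟩ := h.exists_sum_christoffel_mul hφ hu hk (β := fun l ↦ partialDeriv l F u) hdF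
  have hess : ∀ p q, g.hessian φ f u (zIdx p) (zIdx q) =
      partialDeriv (zIdx p) (partialDeriv (zIdx q) F) u +
        (1 / 2) * ∑ a, G a * g.zCompDeriv φ u a p q := fun p q ↦ by
    have := hG p q
    simp only [LorentzMetric.hessian, Matrix.of_apply, ← hF_def, this]
    ring
  -- `X` is the tangential part of `∇²f - c g - ∂²F`: convexity and the second-order condition make it
  -- nonnegative, while its trace is `-c n`, the second fundamental form being traceless.
  set X : Matrix (Fin n) (Fin n) ℝ := Matrix.of fun p q ↦
    (1 / 2) * (∑ a, G a * g.zCompDeriv φ u a p q) - c * g.zComp φ u p q with hX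
  have hnonneg := hk.sum_inv_mul_nonneg X fun v ↦ by
    set V : Fin (2 + n) → ℝ := Fin.append 0 v with hV
    have hVy : ∀ a : Fin 2, V (yIdx a) = 0 := fun a ↦ by simp [hV]
    have hVz : ∀ p : Fin n, V (zIdx p) = v p := fun p ↦ by simp [hV]
    have h1 := hconv φ hφ u hu V
    simp only [Fin.sum_univ_add (a := 2), hVy, hVz, mul_zero, zero_mul, Finset.sum_const_zero,
      zero_add, hess] at h1
    have h2 : ∑ p, ∑ q, X p q * v p * v q =
        ∑ p, ∑ q, (partialDeriv (zIdx p) (partialDeriv (zIdx q) F) u +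
          (1 / 2) * ∑ a, G a * g.zCompDeriv φ u a p q) * v p * v q
        - c * ∑ p, ∑ q, g.comp φ u (zIdx p) (zIdx q) * v p * v q
        - ∑ p, ∑ q, partialDeriv (zIdx p) (partialDeriv (zIdx q) F) u * v p * v q := by
      simp only [Finset.mul_sum, ← Finset.sum_sub_distrib]
      refine Finset.sum_congr rfl fun p _ ↦ Finset.sum_congr rfl fun q _ ↦ ?_
      simp only [hX, Matrix.of_apply, LorentzMetric.zComp, Finset.mul_sum]
      ring
    linarith [(test v).2]
  have hcomp : ∑ p, ∑ q, (g.zComp φ u)⁻¹ p q * X p q = - (c * n) := by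
    have h1 := g.sum_zComp_inv_mul_sum (φ := φ) u G
    simp only [hT, mul_zero, Finset.sum_const_zero] at h1
    rw [← Matrix.sum_inv_mul_self hk, ← zero_sub, ← h1]
    simp only [Finset.mul_sum _ _ c, ← Finset.sum_sub_distrib]
    refine Finset.sum_congr rfl fun p _ ↦ Finset.sum_congr rfl fun q _ ↦ ?_
    rw [hX, Matrix.of_apply]
    ring
  rw [hcomp] at hnonneg
  have : (1 : ℝ) ≤ n := by exact_mod_cast hn
  nlinarith
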